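/- Let $n\ge 5$ and let $G$ be a finite simple graph on $n+2$ vertices which is $3$-connected, i.e. which remains connected whenever at most two vertices are deleted. Then $G$ admits a proper ear decomposition in which every ear has at most $n-1$ vertices. Here a proper ear decomposition of $G$ is a finite sequence $P_1,\dots,P_m$ of subgraphs (the ears) whose union is $G$, such that $P_1$ is a cycle and, for every $i\ge 2$, $P_i$ is a path with two distinct endpoints which meets $P_1\cup\dots\cup P_{i-1}$ in exactly these two endpoints and has no edge in common with $P_1\cup\dots\cup P_{i-1}$. The number of vertices of an ear includes the two endpoints of a path, and all the vertices of the cycle $P_1$ are counted in the same way. -/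

import Mathlib

namespace SimpleGraph

/-- A graph is `k`-connected if it has more than `k` vertices and it remains connected whenever
fewer than `k` vertices are deleted. -/
def IsVertexConnected {V : Type*} (G : SimpleGraph V) (k : ℕ) : Prop :=
  (k : ℕ∞) < ENat.card V ∧
    ∀ s : Finset V, s.card < k → (G.induce ((s : Set V)ᶜ)).Connected

/-- `G.IsProperEarSequence P H` says that the list `P = [P₁, …, Pₘ]` of subgraphs of `G` is a
proper ear decomposition of the subgraph `H` of `G`: the ear `P₁` is a cycle, every later ear is a
path with two distinct endpoints, which meets the union of the preceding ears in exactly these two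
endpoints and shares no edge with it, and `H` is the union of all the ears. -/
inductive IsProperEarSequence {V : Type*} (G : SimpleGraph V) :
    List G.Subgraph → G.Subgraph → Prop
  | cycle (u : V) (c : G.Walk u u) (hc : c.IsCycle) :
      IsProperEarSequence G [c.toSubgraph] c.toSubgraph
  | ear (P : List G.Subgraph) (H : G.Subgraph) (hP : IsProperEarSequence G P H)
      (u v : V) (p : G.Walk u v) (hp : p.IsPath) (huv : u ≠ v)
      (hverts : p.toSubgraph.verts ∩ H.verts = {u, v})
      (hedges : Disjoint p.toSubgraph.edgeSet H.edgeSet) :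
      IsProperEarSequence G (P ++ [p.toSubgraph]) (H ⊔ p.toSubgraph)

/-- The list `P` of subgraphs of `G` is a proper ear decomposition of the whole graph `G`. -/
def IsProperEarDecomposition {V : Type*} (G : SimpleGraph V) (P : List G.Subgraph) : Prop :=
  G.IsProperEarSequence P ⊤

end SimpleGraph

namespace SimpleGraph

variable {V : Type*} {G : SimpleGraph V}

/-! Start from a short cycle and keep adding short ears until nothing is missing; the subgraph grows
strictly, so this stops. A missing edge between two vertices of `H` is itself an ear; otherwise a
vertex lies outside `H`, and a shortest path through the outside is used. Both length bounds
(`exists_isCycle_length_le`, `exists_outer_path`) come from counting: a shortest path is induced, so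
if it were long, minimum degree 3 would force neighbours off it, and these either exceed the `n + 2`
available vertices or yield a shorter path. -/

theorem IsVertexConnected.exists_adj_of_mem_of_notMem {k : ℕ} (hG : G.IsVertexConnected k)
    (s : Finset V) (hs : s.card < k) (A : Set V) {a b : V} (ha : a ∈ A) (has : a ∉ s)
    (hb : b ∉ A) (hbs : b ∉ s) :
    ∃ x y, x ∈ A ∧ x ∉ s ∧ y ∉ A ∧ y ∉ s ∧ G.Adj x y := by
  obtain ⟨w⟩ := (hG.2 s hs).preconnected ⟨a, by simpa using has⟩ ⟨b, by simpa using hbs⟩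
  obtain ⟨d, -, h1, h2⟩ := w.exists_boundary_dart (Subtype.val ⁻¹' A) ha hb
  exact ⟨d.fst, d.snd, h1, fun h => d.fst.2 h, h2, fun h => d.snd.2 h, d.adj⟩

/-- This is minimum degree at least `k`: since `k < |V|`, some vertex lies outside `s ∪ {x}`, and an
edge must leave `{x}` towards it. -/
theorem IsVertexConnected.exists_adj_notMem {k : ℕ} (hG : G.IsVertexConnected k)
    (s : Finset V) (hs : s.card < k) {x : V} (hx : x ∉ s) :
    ∃ y, y ∉ s ∧ G.Adj x y := by
  classical
  obtain ⟨b, hb⟩ : ∃ b, b ∉ insert x s := by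
    by_contra! h
    have h1 : (Set.univ : Set V) = ↑(insert x s) := by ext; simpa using h _
    have h2 : ENat.card V = (insert x s).card := by
      rw [← Set.encard_univ, h1, Set.encard_coe_eq_coe_finsetCard]
    have h3 := hG.1
    rw [h2, Nat.cast_lt, Finset.card_insert_of_notMem hx] at h3
    omega
  rw [Finset.mem_insert, not_or] at hb
  obtain ⟨x', y, rfl, -, -, hy, h⟩ :=
    hG.exists_adj_of_mem_of_notMem s hs {x} rfl hx hb.1 hb.2
  exact ⟨y, hy, h⟩

namespace Walk

/-- Replacing the part of a walk between two of its vertices by an edge. -/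
theorem exists_shortcut {x y : V} (w : G.Walk x y) {i j : ℕ} (hi : i ≤ w.length)
    (h : G.Adj (w.getVert i) (w.getVert j)) :
    ∃ w' : G.Walk x y, w'.support ⊆ w.support ∧ w'.length = i + 1 + (w.length - j) := by
  refine ⟨(w.take i).append (cons h (w.drop j)), fun z hz => ?_, ?_⟩
  · rw [mem_support_append_iff, support_cons, List.mem_cons] at hz
    rcases hz with hz | rfl | hz
    · exact (w.isSubwalk_take i).support_subset hz
    · exact w.getVert_mem_support i
    · exact (w.isSubwalk_drop j).support_subset hz
  · simp [hi]; omega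

/-- A walk that is shortest among those with the same ends and no further vertices. -/
def IsShortestOnSupport {x y : V} (w : G.Walk x y) : Prop :=
  ∀ w' : G.Walk x y, w'.support ⊆ w.support → w.length ≤ w'.length

theorem IsShortestOnSupport.isPath {x y : V} {w : G.Walk x y} (hw : w.IsShortestOnSupport) :
    w.IsPath := by
  classical
  have h := hw w.bypass w.support_bypass_subset_support
  rw [← bypass_eq_self_of_length_le_length_bypass w h]
  exact w.bypass_isPath

theorem IsShortestOnSupport.le_succ_of_adj {x y : V} {w : G.Walk x y}
    (hw : w.IsShortestOnSupport) {i j : ℕ} (hi : i ≤ w.length) (hj : j ≤ w.length)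
    (h : G.Adj (w.getVert i) (w.getVert j)) : j ≤ i + 1 := by
  obtain ⟨w', h1, h2⟩ := w.exists_shortcut hi h
  have := hw w' h1
  omega

end Walk

/-! ### The initial cycle -/

/-- A shortest cycle works, encoded as a vertex `v` and a path `w` between two of its neighbours. If
it were too long, the first three vertices of `w` would have distinct neighbours off the cycle,
giving too many vertices. -/
theorem IsVertexConnected.exists_isCycle_length_le [Fintype V] (hG : G.IsVertexConnected 3)
    {n : ℕ} (hn : 5 ≤ n) (hV : Fintype.card V = n + 2) :
    ∃ (u : V) (c : G.Walk u u), c.IsCycle ∧ c.length ≤ n - 1 := by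
  classical
  let S : ℕ → Prop := fun l => ∃ (v x y : V) (w : G.Walk x y), G.Adj v x ∧ G.Adj v y ∧ x ≠ y ∧
    v ∉ w.support ∧ w.length = l
  have hS : ∃ l, S l := by
    have : Nonempty V := Fintype.card_pos_iff.1 (by omega)
    obtain ⟨v⟩ := this
    obtain ⟨x, -, hx⟩ := hG.exists_adj_notMem ∅ (by simp) (Finset.notMem_empty v)
    obtain ⟨y, hyx, hy⟩ := hG.exists_adj_notMem {x} (by simp) (by simpa using hx.ne)
    obtain ⟨w⟩ := (hG.2 {v} (by simp)).preconnected ⟨x, by simpa using hx.ne'⟩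
      ⟨y, by simpa using hy.ne'⟩
    refine ⟨_, v, x, y, w.map (Embedding.induce _).toHom, hx, hy, ?_, ?_, rfl⟩
    · rintro rfl; simp at hyx
    · intro h
      obtain ⟨z, -, hz⟩ := List.mem_map.1 ((Walk.support_map _ w) ▸ h)
      exact z.2 (by simpa using hz)
  obtain ⟨v, x, y, w, hx, hy, hxy, hv, hl⟩ := Nat.find_spec hS
  have hmin : ∀ (v' x' y' : V) (w' : G.Walk x' y'), G.Adj v' x' → G.Adj v' y' → x' ≠ y' →
      v' ∉ w'.support → w.length ≤ w'.length := fun v' x' y' w' h1 h2 h3 h4 =>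
    hl ▸ Nat.find_min' hS ⟨v', x', y', w', h1, h2, h3, h4, rfl⟩
  have hsh : w.IsShortestOnSupport := fun w' h =>
    hmin v x y w' hx hy hxy (fun h' => hv (h h'))
  have hp := hsh.isPath
  refine ⟨v, Walk.cons hx (w.concat hy.symm), ?_, ?_⟩
  · rw [Walk.cons_isCycle_iff, Walk.concat_isPath_iff, Walk.edges_concat]
    refine ⟨⟨hp, hv⟩, ?_⟩
    rw [List.concat_eq_append, List.mem_append, List.mem_singleton, not_or]
    refine ⟨fun h => hv (w.fst_mem_support_of_mem_edges h), ?_⟩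
    rw [Sym2.eq_iff]
    rintro (⟨rfl, -⟩ | ⟨-, rfl⟩)
    · exact hy.ne rfl
    · exact hxy rfl
  · by_contra hlen
    rw [Walk.length_cons, Walk.length_concat] at hlen
    have hl3 : 3 ≤ w.length := by omega
    have hinj : ∀ i j, i ≤ w.length → j ≤ w.length → w.getVert i = w.getVert j → i = j :=
      fun i j hi hj h => hp.getVert_injOn hi hj h
    have hvadj : ∀ i, 0 < i → i < w.length → ¬ G.Adj v (w.getVert i) := by
      intro i h0 hi h
      have := hmin v x _ (w.take i) hx h
        (fun h => by
          have := hinj 0 i (by omega) (by omega) (by simpa using h)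
          omega)
        (fun h => hv ((w.isSubwalk_take i).support_subset h))
      rw [Walk.take_length] at this
      omega
    have key : ∀ i, i ≤ 2 → ∃ z, G.Adj (w.getVert i) z ∧ z ≠ v ∧ z ∉ w.support := by
      intro i hi
      -- The two neighbours on the cycle; at index 0 the predecessor is `v`.
      let s : Finset V := if i = 0 then {v, w.getVert 1} else {w.getVert (i - 1), w.getVert (i + 1)}
      have hs : s.card < 3 := by
        have : s.card ≤ 2 := by
          dsimp only [s]; split_ifs <;> exact Finset.card_le_two
        omega
      have his : w.getVert i ∉ s := by
        dsimp only [s]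
        split_ifs with h
        · subst h
          rw [Finset.mem_insert, Finset.mem_singleton, not_or]
          refine ⟨fun h => hv (h ▸ w.getVert_mem_support 0), fun h => ?_⟩
          have := hinj _ _ (by omega) (by omega) h
          omega
        · rw [Finset.mem_insert, Finset.mem_singleton, not_or]
          refine ⟨fun h => ?_, fun h => ?_⟩ <;>
          · have := hinj _ _ (by omega) (by omega) h
            omega
      obtain ⟨z, hz, hadj⟩ := hG.exists_adj_notMem s hs his
      refine ⟨z, hadj, ?_, ?_⟩
      · rintro rfl
        rcases Nat.eq_zero_or_pos i with rfl | h0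
        · simp [s] at hz
        · exact hvadj i h0 (by omega) hadj.symm
      · intro hzw
        obtain ⟨j, rfl, hj⟩ := Walk.mem_support_iff_exists_getVert.1 hzw
        have h1 := hsh.le_succ_of_adj (by omega) hj hadj
        have h2 := hsh.le_succ_of_adj hj (by omega) hadj.symm
        have h3 : j ≠ i := by rintro rfl; exact hadj.ne rfl
        apply hz
        dsimp only [s]
        split_ifs with h
        · obtain rfl : j = 1 := by omega
          simp
        · have : j = i - 1 ∨ j = i + 1 := by omega
          rcases this with rfl | rfl <;> simp
    have a01 : G.Adj (w.getVert 0) (w.getVert 1) := w.adj_getVert_succ (by omega)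
    have a12 : G.Adj (w.getVert 1) (w.getVert 2) := w.adj_getVert_succ (by omega)
    obtain ⟨z0, h0, h0v, h0w⟩ := key 0 (by omega)
    obtain ⟨z1, h1, h1v, h1w⟩ := key 1 (by omega)
    obtain ⟨z2, h2, h2v, h2w⟩ := key 2 (by omega)
    have hne : ∀ z i, z ∉ w.support → z ≠ w.getVert i :=
      fun z i hz h => hz (h ▸ w.getVert_mem_support i)
    -- A coincidence would give a triangle or, in `e02`, a 4-cycle, but the minimal cycle has length
    -- at least 5.
    have e01 : z0 ≠ z1 := by
      rintro rfl
      have := hmin z0 _ _ (Walk.cons a01 .nil) h0.symm h1.symm a01.ne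
        (by simpa using ⟨by simpa using hne z0 0 h0w, hne z0 1 h0w⟩)
      simp at this; omega
    have e12 : z1 ≠ z2 := by
      rintro rfl
      have := hmin z1 _ _ (Walk.cons a12 .nil) h1.symm h2.symm a12.ne
        (by simpa using ⟨hne z1 1 h1w, hne z1 2 h1w⟩)
      simp at this; omega
    have e02 : z0 ≠ z2 := by
      rintro rfl
      have := hmin z0 _ _ (Walk.cons a01 (Walk.cons a12 .nil)) h0.symm h2.symm
        (fun h => by have := hinj _ _ (by omega) (by omega) h; omega)
        (by simpa using ⟨by simpa using hne z0 0 h0w, hne z0 1 h0w, hne z0 2 h0w⟩)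
      simp at this; omega
    have hnd : (v :: z0 :: z1 :: z2 :: w.support).Nodup := by
      simp [hp.support_nodup, *, h0v.symm, h1v.symm, h2v.symm]
    have := hnd.length_le_card
    simp at this
    omega

/-! ### Short ears -/

theorem IsVertexConnected.exists_outer_path [Fintype V] (hG : G.IsVertexConnected 3)
    {n : ℕ} (hn : 5 ≤ n) (hV : Fintype.card V = n + 2) (H : Set V) (hH : 3 ≤ H.ncard)
    {o : V} (ho : o ∉ H) :
    ∃ (u v x y : V) (w : G.Walk x y), u ∈ H ∧ v ∈ H ∧ u ≠ v ∧ G.Adj u x ∧ G.Adj y v ∧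
      w.IsPath ∧ (∀ z ∈ w.support, z ∉ H) ∧ w.length + 3 ≤ n - 1 := by
  classical
  have hHt : ∀ u v : V, ∃ t ∈ H, t ≠ u ∧ t ≠ v := by
    intro u v
    by_contra! h
    have h1 : H ⊆ {u, v} := fun t ht => by
      rcases eq_or_ne t u with h' | h'
      · exact Or.inl h'
      · exact Or.inr (h t ht h')
    have h2 := Set.ncard_le_ncard h1 (Set.toFinite _)
    have h3 := Set.ncard_insert_le u {v}
    rw [Set.ncard_singleton] at h3
    omega
  let S : ℕ → Prop := fun l => ∃ (u v x y : V) (w : G.Walk x y), u ∈ H ∧ v ∈ H ∧ u ≠ v ∧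
    G.Adj u x ∧ G.Adj y v ∧ (∀ z ∈ w.support, z ∉ H) ∧ w.length = l
  have hS : ∃ l, S l := by
    obtain ⟨t, ht, -⟩ := hHt o o
    obtain ⟨x, u, hx, -, hu, -, hxu⟩ := hG.exists_adj_of_mem_of_notMem ∅ (by simp) Hᶜ ho
      (Finset.notMem_empty o) (by simpa using ht : t ∉ Hᶜ) (Finset.notMem_empty t)
    rw [Set.notMem_compl_iff] at hu
    obtain ⟨t', ht', htu, -⟩ := hHt u u
    -- The component of `x` outside `H`: after deleting `u`, an edge leaving it can only end in `H`.
    let C : Set V := {y | ∃ w : G.Walk x y, ∀ z ∈ w.support, z ∉ H}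
    obtain ⟨y, v, ⟨w, hw⟩, -, hv, hvu, hyv⟩ := hG.exists_adj_of_mem_of_notMem {u} (by simp) C
      (a := x) (b := t') ⟨.nil, by simpa using hx⟩ (by simpa using hxu.ne)
      (fun ⟨w, hw⟩ => hw t' w.end_mem_support ht') (by simpa using htu)
    refine ⟨_, u, v, x, y, w, hu, ?_, ?_, hxu.symm, hyv, hw, rfl⟩
    · by_contra hvH
      refine hv ⟨w.concat hyv, fun z hz => ?_⟩
      rw [Walk.support_concat, List.mem_append, List.mem_singleton] at hz
      rcases hz with hz | rfl
      · exact hw z hz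
      · exact hvH
    · rintro rfl; simp at hvu
  obtain ⟨u, v, x, y, w, hu, hv, huv, hx, hy, hw, hl⟩ := Nat.find_spec hS
  have hmin : ∀ (u' v' x' y' : V) (w' : G.Walk x' y'), u' ∈ H → v' ∈ H → u' ≠ v' →
      G.Adj u' x' → G.Adj y' v' → (∀ z ∈ w'.support, z ∉ H) → w.length ≤ w'.length :=
    fun u' v' x' y' w' h1 h2 h3 h4 h5 h6 =>
      hl ▸ Nat.find_min' hS ⟨u', v', x', y', w', h1, h2, h3, h4, h5, h6, rfl⟩
  have hsh : w.IsShortestOnSupport := fun w' h =>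
    hmin u v x y w' hu hv huv hx hy (fun z hz => hw z (h hz))
  have hp := hsh.isPath
  refine ⟨u, v, x, y, w, hu, hv, huv, hx, hy, hp, hw, ?_⟩
  by_contra hlen
  have hl2 : 2 ≤ w.length := by omega
  have hleft : ∀ i < w.length, ∀ h ∈ H, G.Adj (w.getVert i) h → h = u := by
    intro i hi h hh hadj
    by_contra hne
    have := hmin u h _ _ (w.take i) hu hh (Ne.symm hne) hx hadj
      (fun z hz => hw z ((w.isSubwalk_take i).support_subset hz))
    rw [Walk.take_length] at this
    omega
  have hright : ∀ i, 0 < i → ∀ h ∈ H, G.Adj (w.getVert i) h → h = v := by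
    intro i hi h hh hadj
    by_contra hne
    have := hmin h v _ _ (w.drop i) hh hv hne hadj.symm hy
      (fun z hz => hw z ((w.isSubwalk_drop i).support_subset hz))
    rw [Walk.drop_length] at this
    omega
  obtain ⟨t, ht, htu, htv⟩ := hHt u v
  -- The path has at least `n - 2` vertices and `u, v, t` are three more, so at most one vertex
  -- remains outside both.
  have hout : ∀ z z', z ∉ H → z ∉ w.support → z' ∉ H → z' ∉ w.support → z = z' := by
    intro z z' hz hzw hz' hzw'
    by_contra hne
    have hnd : (z :: z' :: u :: v :: t :: w.support).Nodup := by
      have hn : ∀ a b, a ∈ H → b ∉ H → a ≠ b := fun a b ha hb h => hb (h ▸ ha)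
      have hs : ∀ a ∈ H, a ∉ w.support := fun a ha h => hw a h ha
      simp [hp.support_nodup, hne, hzw, hzw', hs u hu, hs v hv, hs t ht, huv, htu.symm, htv.symm,
        (hn u z hu hz).symm, (hn v z hv hz).symm, (hn t z ht hz).symm,
        (hn u z' hu hz').symm, (hn v z' hv hz').symm, (hn t z' ht hz').symm]
    have := hnd.length_le_card
    simp at this
    omega
  have hx1 : x ∉ ({u, w.getVert 1} : Finset V) := by
    have h := w.adj_getVert_succ (i := 0) (by omega)
    rw [Walk.getVert_zero] at h
    simpa using ⟨hx.ne', h.ne⟩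
  obtain ⟨z, hz, hxz⟩ := hG.exists_adj_notMem {u, w.getVert 1}
    (Nat.lt_succ_of_le Finset.card_le_two) hx1
  rw [Finset.mem_insert, Finset.mem_singleton, not_or] at hz
  have hzH : z ∉ H := fun h => hz.1 (hleft 0 (by omega) z h (by simpa using hxz))
  have hzw : z ∉ w.support := by
    intro h
    obtain ⟨j, rfl, hj⟩ := Walk.mem_support_iff_exists_getVert.1 h
    have h1 := hsh.le_succ_of_adj (i := 0) (by omega) hj (by simpa using hxz)
    have : j = 0 ∨ j = 1 := by omega
    rcases this with rfl | rfl
    · simp at hxz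
    · exact hz.2 rfl
  -- Without `u, v`, some edge still enters `H`. It cannot start on `w`, so it starts at `z`, and
  -- `u, x, z, b` is a shorter ear.
  obtain ⟨a, b, ha, has, hb, hbs, hab⟩ := hG.exists_adj_of_mem_of_notMem {u, v}
    (Nat.lt_succ_of_le Finset.card_le_two) Hᶜ (a := x) (b := t) (hw x w.start_mem_support)
    (by
      have h1 : x ≠ u := hx.ne'
      have h2 : x ≠ v := fun h => hw x w.start_mem_support (h ▸ hv)
      simp [h1, h2]) (by simpa using ht) (by simp [htu, htv])
  rw [Set.notMem_compl_iff] at hb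
  simp only [Finset.mem_insert, Finset.mem_singleton, not_or] at hbs
  by_cases haw : a ∈ w.support
  · obtain ⟨i, rfl, hi⟩ := Walk.mem_support_iff_exists_getVert.1 haw
    rcases Nat.eq_zero_or_pos i with rfl | h0
    · exact hbs.1 (hleft 0 (by omega) b hb hab)
    · exact hbs.2 (hright i h0 b hb hab)
  · obtain rfl := hout a z ha haw hzH hzw
    have := hmin u b x a (Walk.cons hxz .nil) hu hb (Ne.symm hbs.1) hx hab
      (by simpa using ⟨hw x w.start_mem_support, ha⟩)
    simp at this
    omega

theorem Walk.ncard_verts_toSubgraph_le {u v : V} (p : G.Walk u v) :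
    p.toSubgraph.verts.ncard ≤ p.support.length := by
  classical
  have : p.toSubgraph.verts = (p.support.toFinset : Set V) := by ext; simp
  rw [this, Set.ncard_coe_finset]
  exact List.toFinset_card_le _

theorem IsVertexConnected.exists_ear [Fintype V] (hG : G.IsVertexConnected 3)
    {n : ℕ} (hn : 5 ≤ n) (hV : Fintype.card V = n + 2) (H : G.Subgraph) (hH : 3 ≤ H.verts.ncard)
    (hne : H ≠ ⊤) :
    ∃ (u v : V) (p : G.Walk u v), p.IsPath ∧ u ≠ v ∧ p.toSubgraph.verts ∩ H.verts = {u, v} ∧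
      Disjoint p.toSubgraph.edgeSet H.edgeSet ∧ ¬ p.toSubgraph ≤ H ∧
      p.toSubgraph.verts.ncard ≤ n - 1 := by
  by_cases hch : ∃ a b, a ∈ H.verts ∧ b ∈ H.verts ∧ G.Adj a b ∧ ¬ H.Adj a b
  · obtain ⟨a, b, ha, hb, hab, hnab⟩ := hch
    refine ⟨a, b, Walk.cons hab .nil, by simpa using hab.ne, hab.ne, ?_, ?_, ?_, ?_⟩
    · rw [Set.inter_eq_left.2]
      · ext; simp
      · intro z hz
        rw [Walk.mem_verts_toSubgraph] at hz
        simp at hz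
        rcases hz with rfl | rfl <;> assumption
    · rw [Set.disjoint_left]
      intro e he heH
      rw [Walk.mem_edges_toSubgraph] at he
      simp at he
      subst he
      exact hnab heH
    · intro h
      exact hnab (h.2 (by simp))
    · refine (Walk.ncard_verts_toSubgraph_le _).trans ?_
      simp
      omega
  · push Not at hch
    obtain ⟨o, ho⟩ : ∃ o, o ∉ H.verts := by
      by_contra! h
      refine hne (top_le_iff.1 ⟨fun z _ => h z, fun a b hab => hch a b (h a) (h b) hab⟩)
    obtain ⟨u, v, x, y, w, hu, hv, huv, hx, hy, hp, hw, hl⟩ :=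
      hG.exists_outer_path hn hV H.verts hH ho
    have huw : u ∉ w.support := fun h => hw u h hu
    have hvw : v ∉ w.support := fun h => hw v h hv
    have hsupp : ∀ z, z ∈ (Walk.cons hx (w.concat hy)).support ↔ z = u ∨ z ∈ w.support ∨ z = v := by
      intro z
      simp [Walk.support_concat]
    refine ⟨u, v, Walk.cons hx (w.concat hy), ?_, huv, ?_, ?_, ?_, ?_⟩
    · rw [Walk.cons_isPath_iff, Walk.concat_isPath_iff, Walk.support_concat,
        List.mem_append, List.mem_singleton, not_or]
      exact ⟨⟨hp, hvw⟩, huw, huv⟩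
    · ext z
      rw [Set.mem_inter_iff, Walk.mem_verts_toSubgraph, hsupp]
      constructor
      · rintro ⟨rfl | h | rfl, hz⟩
        · exact Or.inl rfl
        · exact (hw z h hz).elim
        · exact Or.inr rfl
      · rintro (rfl | rfl)
        · exact ⟨Or.inl rfl, hu⟩
        · exact ⟨Or.inr (Or.inr rfl), hv⟩
    · rw [Set.disjoint_left]
      intro e he heH
      have hend : ∀ z ∈ e, z ∈ H.verts := fun z hz => H.mem_verts_of_mem_edge heH hz
      rw [Walk.mem_edges_toSubgraph, Walk.edges_cons, Walk.edges_concat,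
        List.concat_eq_append, List.mem_cons, List.mem_append, List.mem_singleton] at he
      rcases he with rfl | he | rfl
      · exact hw x w.start_mem_support (hend x (by simp))
      · induction e with
        | h a b => exact hw a (w.fst_mem_support_of_mem_edges he) (hend a (by simp))
      · exact hw y w.end_mem_support (hend y (by simp))
    · intro h
      exact hw x w.start_mem_support
        (h.1 ((Walk.mem_verts_toSubgraph _).2 ((hsupp x).2 (Or.inr (Or.inl w.start_mem_support)))))
    · refine (Walk.ncard_verts_toSubgraph_le _).trans ?_
      simp [Walk.support_concat]
      omega

theorem Walk.IsCycle.three_le_ncard_verts {u : V} {c : G.Walk u u} (hc : c.IsCycle) :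
    3 ≤ c.toSubgraph.verts.ncard := by
  classical
  have h : (c.support.tail.toFinset : Set V) ⊆ c.toSubgraph.verts := fun z hz => by
    rw [Walk.mem_verts_toSubgraph]
    exact List.mem_of_mem_tail (by simpa using hz)
  have h1 := Set.ncard_le_ncard h (by
    have : c.toSubgraph.verts = (c.support.toFinset : Set V) := by ext; simp
    exact this ▸ Finset.finite_toSet _)
  rw [Set.ncard_coe_finset, List.toFinset_card_of_nodup hc.support_nodup] at h1
  have := hc.three_le_length
  rw [List.length_tail, Walk.length_support] at h1
  omega

/-- The support lists the base point twice, so its tail already covers all vertices. -/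
theorem Walk.IsCycle.ncard_verts_le_length {u : V} {c : G.Walk u u} (hc : c.IsCycle) :
    c.toSubgraph.verts.ncard ≤ c.length := by
  classical
  have h : c.toSubgraph.verts = (c.support.tail.toFinset : Set V) := by
    ext z
    rw [Walk.mem_verts_toSubgraph, Finset.mem_coe, List.mem_toFinset]
    refine ⟨fun hz => ?_, List.mem_of_mem_tail⟩
    rcases (Walk.mem_support_iff c).1 hz with rfl | hz
    · exact Walk.end_mem_tail_support hc.not_nil
    · exact hz
  rw [h, Set.ncard_coe_finset]
  refine (List.toFinset_card_le _).trans ?_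
  simp

theorem IsVertexConnected.exists_earDecomposition_of_earSequence [Fintype V]
    (hG : G.IsVertexConnected 3) {n : ℕ} (hn : 5 ≤ n) (hV : Fintype.card V = n + 2)
    (H : G.Subgraph) (hH : 3 ≤ H.verts.ncard) (P : List G.Subgraph)
    (hP : G.IsProperEarSequence P H) (hPn : ∀ p ∈ P, p.verts.ncard ≤ n - 1) :
    ∃ P : List G.Subgraph, G.IsProperEarDecomposition P ∧ ∀ p ∈ P, p.verts.ncard ≤ n - 1 := by
  classical
  induction H using (wellFounded_gt (α := G.Subgraph)).induction generalizing P with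
  | _ H ih =>
    by_cases hne : H = ⊤
    · subst hne
      exact ⟨P, hP, hPn⟩
    · obtain ⟨u, v, p, hp, huv, hverts, hedges, hle, hcard⟩ := hG.exists_ear hn hV H hH hne
      refine ih (H ⊔ p.toSubgraph) (left_lt_sup.2 hle)
        (hH.trans (Set.ncard_le_ncard (le_sup_left : H ≤ H ⊔ p.toSubgraph).1 (Set.toFinite _)))
        _ (.ear P H hP u v p hp huv hverts hedges) fun q hq => ?_
      rcases List.mem_append.1 hq with hq | hq
      · exact hPn q hq
      · rwa [List.mem_singleton.1 hq]

end SimpleGraph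

theorem mainTheorem7 {V : Type*} [Fintype V] (G : SimpleGraph V) (n : ℕ) (hn : 5 ≤ n)
    (hV : Fintype.card V = n + 2) (hG : G.IsVertexConnected 3) :
    ∃ P : List G.Subgraph, G.IsProperEarDecomposition P ∧
      ∀ p ∈ P, p.verts.ncard ≤ n - 1 := by
  obtain ⟨u, c, hc, hl⟩ := hG.exists_isCycle_length_le hn hV
  refine hG.exists_earDecomposition_of_earSequence hn hV _ hc.three_le_ncard_verts _
    (.cycle u c hc) fun p hp => ?_
  rw [List.mem_singleton.1 hp]
  exact hc.ncard_verts_le_length.trans hl
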